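/- Let $R$ be a commutative Noetherian ring and let $I,J$ be ideals of $R$. For an ideal $\mathfrak a$ of $R$ and a finitely generated $R$-module $X$, let $\operatorname{depth}(\mathfrak a,X)$ be the supremum of the lengths of the $X$-regular sequences contained in $\mathfrak a$ if $\mathfrak aX\neq X$, and $\operatorname{depth}(\mathfrak a,X)=\infty$ if $\mathfrak aX=X$. Let $\tilde W(I,J)$ be the set of all ideals $\mathfrak a$ of $R$ such that $I^n\subseteq\mathfrak a+J$ for some integer $n\ge 1$, and put $$\operatorname{depth}(I,J,X)=\inf\{\operatorname{depth}(\mathfrak a,X)\mid \mathfrak a\in\tilde W(I,J)\}\in\mathbb N_0\cup\{\infty\}.$$ Let $0\to U\to M\to N\to 0$ be an exact sequence of finitely generated $R$-modules, and let $r=\operatorname{depth}(I,J,U)$, $t=\operatorname{depth}(I,J,M)$, $s=\operatorname{depth}(I,J,N)$. Then (with $\infty\pm1=\infty$): 1. $t\ge\min\{r,s\}$; 2. $r\ge\min\{t,s+1\}$; 3. $s\ge\min\{r-1,t\}$; 4. one of the following equalities holds: $t=r$, $t=s$, $t=r=s$, $s=r-1$. -/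

import Mathlib

/-- The set of all ideals `𝔞` of `R` such that `I ^ n ⊆ 𝔞 + J` for some `n`.
(Allowing `n = 0` makes no difference: `R ⊆ 𝔞 + J` implies `I ^ 1 ⊆ 𝔞 + J`.) -/
def idealsWTilde {R : Type*} [CommRing R] (I J : Ideal R) : Set (Ideal R) :=
  {𝔞 | ∃ n : ℕ, I ^ n ≤ 𝔞 ⊔ J}

open Classical in
/-- The depth (grade) of an ideal `𝔞` on a module `M`: the supremum of the lengths of the
`M`-regular sequences contained in `𝔞` if `𝔞 M ≠ M`, and `∞` if `𝔞 M = M`. -/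
noncomputable def idealDepth {R : Type*} [CommRing R] (𝔞 : Ideal R)
    (M : Type*) [AddCommGroup M] [Module R M] : ℕ∞ :=
  if 𝔞 • (⊤ : Submodule R M) = ⊤ then ⊤
  else sSup {d : ℕ∞ | ∃ rs : List R,
    (∀ x ∈ rs, x ∈ 𝔞) ∧ RingTheory.Sequence.IsRegular M rs ∧ (rs.length : ℕ∞) = d}

/-- The depth of the pair of ideals `(I, J)` on `M`: the infimum in `ℕ ∪ {∞}` of the depths
on `M` of all ideals `𝔞` such that `I ^ n ⊆ 𝔞 + J` for some `n`. -/
noncomputable def pairDepth {R : Type*} [CommRing R] (I J : Ideal R)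
    (M : Type*) [AddCommGroup M] [Module R M] : ℕ∞ :=
  sInf {d : ℕ∞ | ∃ 𝔞 ∈ idealsWTilde I J, idealDepth 𝔞 M = d}

/-! For every natural `n`, `n ≤ depth(I, J, X)` says that each admissible ideal `𝔞` contains a
weakly `X`-regular sequence of length `n` (`natCast_le_pairDepth_iff`), so the inequalities reduce
to the depth lemma for a single ideal. That lemma goes by induction on `n`, without Ext: reduce the
sequence modulo some `x ∈ 𝔞` regular on all three modules; exactness survives because `x` is
`N`-regular. Such an `x` exists because having no `𝔞`-torsion is equivalent to having a regular
element in `𝔞` and passes to products. Any regular `x ∈ 𝔞` may be used, by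
`DepthAtLeast.quotSMulTop_congr`. -/

open scoped Pointwise

/-! ### Regular elements and torsion with respect to an ideal -/

section RegularElements

variable {R : Type*} [CommRing R]

lemma QuotSMulTop.mk_eq_zero_iff {X : Type*} [AddCommGroup X] [Module R X] {x : R} {m : X} :
    (Submodule.Quotient.mk m : QuotSMulTop x X) = 0 ↔ ∃ m', x • m' = m := by
  rw [Submodule.Quotient.mk_eq_zero, Submodule.mem_smul_pointwise_iff_exists]
  simp

/-- If `x` is regular on the last term of a short exact sequence, reduction modulo `x` preserves
injectivity of the first map. -/
lemma QuotSMulTop.map_injective_of_isSMulRegular {U M N : Type*}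
    [AddCommGroup U] [Module R U] [AddCommGroup M] [Module R M] [AddCommGroup N] [Module R N]
    {f : U →ₗ[R] M} {g : M →ₗ[R] N} (hf : Function.Injective f) (hfg : Function.Exact f g)
    {x : R} (hx : IsSMulRegular N x) : Function.Injective (QuotSMulTop.map x f) := by
  rw [injective_iff_map_eq_zero]
  intro u
  obtain ⟨u, rfl⟩ := Submodule.Quotient.mk_surjective _ u
  rw [QuotSMulTop.map_apply_mk, QuotSMulTop.mk_eq_zero_iff, QuotSMulTop.mk_eq_zero_iff]
  rintro ⟨m, hm⟩
  have hgm : g m = 0 := hx.right_eq_zero_of_smul <| by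
    rw [← map_smul, hm, hfg.apply_apply_eq_zero]
  obtain ⟨u', rfl⟩ := (hfg m).mp hgm
  exact ⟨u', hf (by rw [map_smul, hm])⟩

/-- If `x` is regular on `X` and `z` is regular on `X ⧸ xX`, then `x` is regular on
`X ⧸ zX`. -/
lemma IsSMulRegular.quotSMulTop_swap {X : Type*} [AddCommGroup X] [Module R X] {x z : R}
    (hx : IsSMulRegular X x) (hxz : IsSMulRegular (QuotSMulTop x X) z) :
    IsSMulRegular (QuotSMulTop z X) x := by
  refine .of_right_eq_zero_of_smul fun m hm => ?_
  obtain ⟨m, rfl⟩ := Submodule.Quotient.mk_surjective _ m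
  rw [← Submodule.Quotient.mk_smul, QuotSMulTop.mk_eq_zero_iff] at hm
  obtain ⟨m', hm'⟩ := hm
  have h0 : (Submodule.Quotient.mk m' : QuotSMulTop x X) = 0 :=
    hxz.right_eq_zero_of_smul <| by
      rw [← Submodule.Quotient.mk_smul, QuotSMulTop.mk_eq_zero_iff]
      exact ⟨m, hm'.symm⟩
  obtain ⟨m'', rfl⟩ := QuotSMulTop.mk_eq_zero_iff.mp h0
  rw [QuotSMulTop.mk_eq_zero_iff]
  exact ⟨m'', hx (by simpa only [smul_comm x z] using hm')⟩

/-- The two successive reductions modulo `x` and `z` do not depend on the order. -/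
noncomputable def QuotSMulTop.comm (X : Type*) [AddCommGroup X] [Module R X] (x z : R) :
    QuotSMulTop z (QuotSMulTop x X) ≃ₗ[R] QuotSMulTop x (QuotSMulTop z X) :=
  let e (x z : R) : QuotSMulTop z (QuotSMulTop x X) ≃ₗ[R]
      X ⧸ (x • (⊤ : Submodule R X) ⊔ z • (⊤ : Submodule R X)) :=
    Submodule.quotEquivOfEq _ _
      (by rw [Submodule.map_pointwise_smul, Submodule.map_top, Submodule.range_mkQ]) ≪≫ₗ
    Submodule.quotientQuotientEquivQuotientSup _ _
  e x z ≪≫ₗ Submodule.quotEquivOfEq _ _ (sup_comm _ _) ≪≫ₗ (e z x).symm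

/-- `X` has no nonzero element annihilated by the ideal `𝔞`. -/
def NoIdealTorsion (𝔞 : Ideal R) (X : Type*) [AddCommGroup X] [Module R X] : Prop :=
  ∀ m : X, (∀ b ∈ 𝔞, b • m = 0) → m = 0

lemma NoIdealTorsion.prod {𝔞 : Ideal R} {X Y : Type*} [AddCommGroup X] [Module R X]
    [AddCommGroup Y] [Module R Y] (hX : NoIdealTorsion 𝔞 X) (hY : NoIdealTorsion 𝔞 Y) :
    NoIdealTorsion 𝔞 (X × Y) := fun m hm =>
  Prod.ext (hX m.1 fun b hb => congrArg Prod.fst (hm b hb))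
    (hY m.2 fun b hb => congrArg Prod.snd (hm b hb))

lemma noIdealTorsion_of_isSMulRegular {𝔞 : Ideal R} {X : Type*} [AddCommGroup X] [Module R X]
    {x : R} (hx : x ∈ 𝔞) (hreg : IsSMulRegular X x) : NoIdealTorsion 𝔞 X :=
  fun _ hm => hreg.right_eq_zero_of_smul (hm x hx)

/-- If `x ∈ 𝔞` is regular on `M` and `U ⧸ xU` has no `𝔞`-torsion, neither does `N`. -/
lemma NoIdealTorsion.right_of_exact {U M N : Type*} [AddCommGroup U] [Module R U]
    [AddCommGroup M] [Module R M] [AddCommGroup N] [Module R N] {f : U →ₗ[R] M} {g : M →ₗ[R] N}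
    (hf : Function.Injective f) (hfg : Function.Exact f g)
    (hg : Function.Surjective g) {𝔞 : Ideal R}
    {x : R} (hx : x ∈ 𝔞) (hxM : IsSMulRegular M x)
    (hU : NoIdealTorsion 𝔞 (QuotSMulTop x U)) : NoIdealTorsion 𝔞 N := by
  intro m hm
  obtain ⟨m, rfl⟩ := hg m
  have hm' : ∀ b ∈ 𝔞, ∃ u, f u = b • m := fun b hb => (hfg _).mp (by rw [map_smul, hm b hb])
  -- If `x • m = f u` and `b • m = f v`, then `b • u = x • v`: the class of `u` modulo `x` is
  -- `𝔞`-torsion.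
  obtain ⟨u, hu⟩ := hm' x hx
  have hu0 : (Submodule.Quotient.mk u : QuotSMulTop x U) = 0 := hU _ fun b hb => by
    obtain ⟨v, hv⟩ := hm' b hb
    rw [← Submodule.Quotient.mk_smul, QuotSMulTop.mk_eq_zero_iff]
    exact ⟨v, hf (by rw [map_smul, map_smul, hv, hu, smul_comm])⟩
  obtain ⟨u', rfl⟩ := QuotSMulTop.mk_eq_zero_iff.mp hu0
  rw [map_smul] at hu
  rw [← hxM hu, hfg.apply_apply_eq_zero]

/-- A map `R ⧸ 𝔞 → X` is determined by the image of `1`, which `𝔞` kills; so `Hom(R ⧸ 𝔞, X) = 0`,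
which yields a regular element in `𝔞`. -/
lemma NoIdealTorsion.exists_isSMulRegular [IsNoetherianRing R] {𝔞 : Ideal R} {X : Type*}
    [AddCommGroup X] [Module R X] [Module.Finite R X] (h : NoIdealTorsion 𝔞 X) :
    ∃ x ∈ 𝔞, IsSMulRegular X x := by
  have hsub : Subsingleton ((R ⧸ 𝔞) →ₗ[R] X) := by
    refine subsingleton_of_forall_eq 0 fun φ => Submodule.linearMap_qext _ ?_
    ext
    refine h _ fun b hb => ?_
    rw [← map_smul]
    have : (b • (1 : R)) ∈ 𝔞 := by simpa using hb
    rw [LinearMap.comp_apply, Submodule.mkQ_apply, (Submodule.Quotient.mk_eq_zero 𝔞).mpr this,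
      map_zero]
  obtain ⟨r, hr, hreg⟩ := IsSMulRegular.subsingleton_linearMap_iff.mp hsub
  exact ⟨r, by rwa [Ideal.annihilator_quotient] at hr, hreg⟩

lemma NoIdealTorsion.exists_isSMulRegular₂ [IsNoetherianRing R] {𝔞 : Ideal R} {X Y : Type*}
    [AddCommGroup X] [Module R X] [Module.Finite R X]
    [AddCommGroup Y] [Module R Y] [Module.Finite R Y]
    (hX : NoIdealTorsion 𝔞 X) (hY : NoIdealTorsion 𝔞 Y) :
    ∃ x ∈ 𝔞, IsSMulRegular X x ∧ IsSMulRegular Y x := by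
  obtain ⟨x, hx, hreg⟩ := (hX.prod hY).exists_isSMulRegular
  exact ⟨x, hx, hreg.of_injective (LinearMap.inl R X Y) LinearMap.inl_injective,
    hreg.of_injective (LinearMap.inr R X Y) LinearMap.inr_injective⟩

end RegularElements

/-! ### Depth of one ideal through weakly regular sequences -/

section DepthAtLeast

variable {R : Type*} [CommRing R]

/-- The ideal `𝔞` contains a weakly `X`-regular sequence of length `n`. For finite `X` over a
Noetherian ring this says that the depth of `𝔞` on `X` is at least `n`. -/
def DepthAtLeast (𝔞 : Ideal R) (n : ℕ) (X : Type*) [AddCommGroup X] [Module R X] : Prop :=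
  ∃ rs : List R, rs.length = n ∧ (∀ x ∈ rs, x ∈ 𝔞) ∧ RingTheory.Sequence.IsWeaklyRegular X rs

variable {𝔞 : Ideal R}

lemma DepthAtLeast.zero (X : Type*) [AddCommGroup X] [Module R X] : DepthAtLeast 𝔞 0 X :=
  ⟨[], rfl, by simp, .nil R X⟩

lemma depthAtLeast_succ_iff {n : ℕ} {X : Type*} [AddCommGroup X] [Module R X] :
    DepthAtLeast 𝔞 (n + 1) X ↔
      ∃ x ∈ 𝔞, IsSMulRegular X x ∧ DepthAtLeast 𝔞 n (QuotSMulTop x X) := by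
  constructor
  · rintro ⟨_ | ⟨x, rs⟩, hlen, hmem, hreg⟩
    · simp at hlen
    · rw [RingTheory.Sequence.isWeaklyRegular_cons_iff] at hreg
      exact ⟨x, hmem x (by simp), hreg.1, rs, by simpa using hlen,
        fun y hy => hmem y (by simp [hy]), hreg.2⟩
  · rintro ⟨x, hx, hreg, rs, rfl, hmem, hrs⟩
    exact ⟨x :: rs, rfl, by simpa [hx] using hmem, .cons hreg hrs⟩

lemma DepthAtLeast.of_linearEquiv {n : ℕ} {X Y : Type*} [AddCommGroup X] [Module R X]
    [AddCommGroup Y] [Module R Y] (e : X ≃ₗ[R] Y) (h : DepthAtLeast 𝔞 n X) :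
    DepthAtLeast 𝔞 n Y := by
  obtain ⟨rs, hlen, hmem, hreg⟩ := h
  exact ⟨rs, hlen, hmem, (e.isWeaklyRegular_congr rs).mp hreg⟩

lemma DepthAtLeast.noIdealTorsion {n : ℕ} {X : Type*} [AddCommGroup X] [Module R X]
    (h : DepthAtLeast 𝔞 (n + 1) X) : NoIdealTorsion 𝔞 X := by
  obtain ⟨x, hx, hreg, -⟩ := depthAtLeast_succ_iff.mp h
  exact noIdealTorsion_of_isSMulRegular hx hreg

/-- For `X`-regular elements `x` and `y` with `x ∈ 𝔞`, if `X ⧸ xX` has no `𝔞`-torsion, neither has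
`X ⧸ yX`. -/
lemma NoIdealTorsion.quotSMulTop_congr {X : Type*} [AddCommGroup X] [Module R X] {x y : R}
    (hx : x ∈ 𝔞) (hxr : IsSMulRegular X x) (hyr : IsSMulRegular X y)
    (h : NoIdealTorsion 𝔞 (QuotSMulTop x X)) : NoIdealTorsion 𝔞 (QuotSMulTop y X) := by
  intro m hm
  obtain ⟨m, rfl⟩ := Submodule.Quotient.mk_surjective _ m
  have hm' : ∀ b ∈ 𝔞, ∃ m', y • m' = b • m := fun b hb => by
    rw [← QuotSMulTop.mk_eq_zero_iff, Submodule.Quotient.mk_smul, hm b hb]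
  -- The relation `y • w = x • m` carries torsion classes of `X ⧸ yX` to torsion classes of `X ⧸
  -- xX`.
  obtain ⟨w, hw⟩ := hm' x hx
  have hw0 : (Submodule.Quotient.mk w : QuotSMulTop x X) = 0 := h _ fun b hb => by
    obtain ⟨v, hv⟩ := hm' b hb
    rw [← Submodule.Quotient.mk_smul, QuotSMulTop.mk_eq_zero_iff]
    refine ⟨v, hyr ?_⟩
    simp only
    rw [smul_comm y x, hv, smul_comm y b, hw, smul_comm]
  obtain ⟨w', rfl⟩ := QuotSMulTop.mk_eq_zero_iff.mp hw0
  rw [QuotSMulTop.mk_eq_zero_iff]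
  exact ⟨w', hxr (by simpa only [smul_comm x y] using hw)⟩

/-- The depth of `X ⧸ xX` does not depend on the `X`-regular element `x` of `𝔞`. -/
lemma DepthAtLeast.quotSMulTop_congr [IsNoetherianRing R] {n : ℕ} {X : Type*} [AddCommGroup X]
    [Module R X] [Module.Finite R X] {x y : R} (hx : x ∈ 𝔞) (hy : y ∈ 𝔞)
    (hxr : IsSMulRegular X x) (hyr : IsSMulRegular X y)
    (h : DepthAtLeast 𝔞 n (QuotSMulTop x X)) : DepthAtLeast 𝔞 n (QuotSMulTop y X) := by
  induction n generalizing X x y with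
  | zero => exact .zero _
  | succ n ih =>
    have hX := noIdealTorsion_of_isSMulRegular hx hxr
    have hXx := h.noIdealTorsion
    have hXy := hXx.quotSMulTop_congr hx hxr hyr
    -- An auxiliary `z` regular on `X`, `X ⧸ xX` and `X ⧸ yX` mediates: trade `w` for `z` on `X ⧸
    -- xX`, then `x` for `y` on `X ⧸ zX`.
    obtain ⟨z, hz, hzr, hzxy⟩ := hX.exists_isSMulRegular₂ (hXx.prod hXy)
    have hzx := hzxy.of_injective (LinearMap.inl R _ _) LinearMap.inl_injective
    have hzy := hzxy.of_injective (LinearMap.inr R _ _) LinearMap.inr_injective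
    obtain ⟨w, hw, hwr, hwn⟩ := depthAtLeast_succ_iff.mp h
    have h₁ : DepthAtLeast 𝔞 n (QuotSMulTop z (QuotSMulTop x X)) := ih hw hz hwr hzx hwn
    have h₂ : DepthAtLeast 𝔞 n (QuotSMulTop x (QuotSMulTop z X)) :=
      h₁.of_linearEquiv (QuotSMulTop.comm X x z)
    have h₃ : DepthAtLeast 𝔞 n (QuotSMulTop y (QuotSMulTop z X)) :=
      ih hx hy (hxr.quotSMulTop_swap hzx) (hyr.quotSMulTop_swap hzy) h₂
    exact depthAtLeast_succ_iff.mpr ⟨z, hz, hzy, h₃.of_linearEquiv (QuotSMulTop.comm X z y)⟩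

lemma DepthAtLeast.quotSMulTop [IsNoetherianRing R] {n : ℕ} {X : Type*} [AddCommGroup X]
    [Module R X] [Module.Finite R X] {x : R} (hx : x ∈ 𝔞) (hxr : IsSMulRegular X x)
    (h : DepthAtLeast 𝔞 (n + 1) X) : DepthAtLeast 𝔞 n (QuotSMulTop x X) := by
  obtain ⟨y, hy, hyr, hyn⟩ := depthAtLeast_succ_iff.mp h
  exact hyn.quotSMulTop_congr hy hx hyr hxr

/-- Covers the infinite-depth case `𝔞X = X`, where Nakayama provides such an `x`; weak regularity
tolerates zero quotients. -/
lemma DepthAtLeast.of_exists_smul_eq_self {X : Type*} [AddCommGroup X] [Module R X]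
    (h : ∃ x ∈ 𝔞, ∀ m : X, x • m = m) (n : ℕ) : DepthAtLeast 𝔞 n X := by
  induction n generalizing X with
  | zero => exact .zero _
  | succ n ih =>
    obtain ⟨x, hx, hid⟩ := h
    refine depthAtLeast_succ_iff.mpr ⟨x, hx, fun a b hab => ?_, ih ⟨x, hx, fun m => ?_⟩⟩
    · simpa only [hid] using hab
    · obtain ⟨m, rfl⟩ := Submodule.Quotient.mk_surjective _ m
      rw [← Submodule.Quotient.mk_smul, hid]

lemma natCast_le_idealDepth_iff {X : Type*} [AddCommGroup X] [Module R X] [Module.Finite R X]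
    {n : ℕ} : (n : ℕ∞) ≤ idealDepth 𝔞 X ↔ DepthAtLeast 𝔞 n X := by
  unfold idealDepth
  split_ifs with htop
  · refine iff_of_true le_top (.of_exists_smul_eq_self ?_ n)
    obtain ⟨x, hx, h⟩ := Submodule.exists_mem_and_smul_eq_self_of_fg_of_le_smul 𝔞
      (⊤ : Submodule R X) Module.Finite.fg_top htop.ge
    exact ⟨x, hx, fun m => h m trivial⟩
  · constructor
    · intro h
      obtain _ | n := n
      · exact .zero _
      -- The supremum need not be attained, so take a sequence longer than `n` and truncate it.
      obtain ⟨_, ⟨rs, hmem, hreg, rfl⟩, hlt⟩ :=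
        lt_sSup_iff.mp ((ENat.natCast_lt_natCast.mpr n.lt_succ_self).trans_le h)
      have hlen : n + 1 ≤ rs.length := ENat.natCast_lt_natCast.mp hlt
      refine ⟨rs.take (n + 1), by simpa using hlen, fun x hx => hmem x (List.mem_of_mem_take hx),
        ?_⟩
      rw [← List.take_append_drop (n + 1) rs] at hreg
      exact ((RingTheory.Sequence.isWeaklyRegular_append_iff X _ _).mp hreg.toIsWeaklyRegular).1
    · rintro ⟨rs, rfl, hmem, hreg⟩
      refine le_sSup ⟨rs, hmem, ⟨hreg, fun h => htop (top_le_iff.mp (h.le.trans ?_))⟩, rfl⟩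
      exact Submodule.smul_mono_left (Ideal.span_le.mpr hmem)

lemma natCast_le_pairDepth_iff {I J : Ideal R} {X : Type*} [AddCommGroup X] [Module R X]
    [Module.Finite R X] {n : ℕ} :
    (n : ℕ∞) ≤ pairDepth I J X ↔ ∀ 𝔞 ∈ idealsWTilde I J, DepthAtLeast 𝔞 n X := by
  simp only [pairDepth, le_sInf_iff, Set.mem_ofPred_eq, forall_exists_index, and_imp,
    forall_apply_eq_imp_iff₂, natCast_le_idealDepth_iff]

end DepthAtLeast

/-! ### The depth lemma for one ideal -/

section ShortExact

variable {R : Type*} [CommRing R] [IsNoetherianRing R] {𝔞 : Ideal R}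
  {U M N : Type*} [AddCommGroup U] [Module R U] [Module.Finite R U]
  [AddCommGroup M] [Module R M] [Module.Finite R M]
  [AddCommGroup N] [Module R N] [Module.Finite R N]
  {f : U →ₗ[R] M} {g : M →ₗ[R] N}

lemma DepthAtLeast.middle_of_exact (hf : Function.Injective f) (hfg : Function.Exact f g)
    (hg : Function.Surjective g) {n : ℕ} (hU : DepthAtLeast 𝔞 n U) (hN : DepthAtLeast 𝔞 n N) :
    DepthAtLeast 𝔞 n M := by
  induction n generalizing U M N with
  | zero => exact .zero _
  | succ n ih =>
    obtain ⟨x, hx, hxU, hxN⟩ := hU.noIdealTorsion.exists_isSMulRegular₂ hN.noIdealTorsion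
    have hxM : IsSMulRegular M x :=
      isSMulRegular_of_range_eq_ker hf hfg.linearMap_ker_eq.symm hxU hxN
    exact depthAtLeast_succ_iff.mpr ⟨x, hx, hxM,
      ih (QuotSMulTop.map_injective_of_isSMulRegular hf hfg hxN) (QuotSMulTop.map_exact x hfg hg)
        (QuotSMulTop.map_surjective x hg) (hU.quotSMulTop hx hxU) (hN.quotSMulTop hx hxN)⟩

lemma DepthAtLeast.left_of_exact (hf : Function.Injective f) (hfg : Function.Exact f g)
    (hg : Function.Surjective g) {n : ℕ} (hM : DepthAtLeast 𝔞 (n + 1) M)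
    (hN : DepthAtLeast 𝔞 n N) : DepthAtLeast 𝔞 (n + 1) U := by
  induction n generalizing U M N with
  | zero =>
    obtain ⟨x, hx, hxM, -⟩ := depthAtLeast_succ_iff.mp hM
    exact depthAtLeast_succ_iff.mpr ⟨x, hx, hxM.of_injective f hf, .zero _⟩
  | succ n ih =>
    obtain ⟨x, hx, hxM, hxN⟩ := hM.noIdealTorsion.exists_isSMulRegular₂ hN.noIdealTorsion
    exact depthAtLeast_succ_iff.mpr ⟨x, hx, hxM.of_injective f hf,
      ih (QuotSMulTop.map_injective_of_isSMulRegular hf hfg hxN) (QuotSMulTop.map_exact x hfg hg)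
        (QuotSMulTop.map_surjective x hg) (hM.quotSMulTop hx hxM) (hN.quotSMulTop hx hxN)⟩

lemma DepthAtLeast.right_of_exact (hf : Function.Injective f) (hfg : Function.Exact f g)
    (hg : Function.Surjective g) {n : ℕ} (hU : DepthAtLeast 𝔞 (n + 1) U)
    (hM : DepthAtLeast 𝔞 n M) : DepthAtLeast 𝔞 n N := by
  induction n generalizing U M N with
  | zero => exact .zero _
  | succ n ih =>
    obtain ⟨y, hy, hyM, -⟩ := depthAtLeast_succ_iff.mp hM
    -- Nothing is assumed about `N`, so a first element `y`, regular on `M` only, excludes torsion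
    -- in `N`; then `x` is chosen regular on both.
    have hN : NoIdealTorsion 𝔞 N := .right_of_exact hf hfg hg hy hyM
      (hU.quotSMulTop hy (hyM.of_injective f hf)).noIdealTorsion
    obtain ⟨x, hx, hxM, hxN⟩ := hM.noIdealTorsion.exists_isSMulRegular₂ hN
    exact depthAtLeast_succ_iff.mpr ⟨x, hx, hxN,
      ih (QuotSMulTop.map_injective_of_isSMulRegular hf hfg hxN) (QuotSMulTop.map_exact x hfg hg)
        (QuotSMulTop.map_surjective x hg) (hU.quotSMulTop hx (hxM.of_injective f hf))
        (hM.quotSMulTop hx hxM)⟩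

end ShortExact

/-- `t < r` forces `t = s`, and `r < t` forces `s + 1 = r`. -/
lemma ENat.eq_or_eq_or_add_one_eq_of_min_le {r t s : ℕ∞} (h₁ : min r s ≤ t)
    (h₂ : min t (s + 1) ≤ r) (h₃ : min (r - 1) t ≤ s) : t = r ∨ t = s ∨ s + 1 = r := by
  rcases lt_trichotomy t r with h | h | h
  · have hst : s ≤ t := (min_le_iff.mp h₁).resolve_left h.not_ge
    have htr : t ≤ r - 1 := ENat.le_sub_of_add_le_right ENat.one_ne_top (Order.add_one_le_of_lt h)
    exact .inr (.inl (le_antisymm (by rwa [min_eq_right htr] at h₃) hst))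
  · exact .inl h
  · have hsr : s + 1 ≤ r := (min_le_iff.mp h₂).resolve_left h.not_ge
    rcases min_le_iff.mp h₃ with h' | h'
    · exact .inr (.inr (le_antisymm hsr (tsub_le_iff_right.mp h')))
    · exact absurd (h.trans_le (h'.trans (le_self_add.trans hsr))) (lt_irrefl r)

theorem proposition3p6 {R : Type*} [CommRing R] [IsNoetherianRing R] (I J : Ideal R)
    {U M N : Type*}
    [AddCommGroup U] [Module R U] [Module.Finite R U]
    [AddCommGroup M] [Module R M] [Module.Finite R M]
    [AddCommGroup N] [Module R N] [Module.Finite R N]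
    (f : U →ₗ[R] M) (g : M →ₗ[R] N)
    (hf : Function.Injective f) (hfg : Function.Exact f g) (hg : Function.Surjective g)
    (r t s : ℕ∞)
    (hr : r = pairDepth I J U) (ht : t = pairDepth I J M) (hs : s = pairDepth I J N) :
    min r s ≤ t ∧
    min t (s + 1) ≤ r ∧
    -- truncation is harmless here: for `r = 0` both `0 ≤ s` and `-1 ≤ s` are true
    min (r - 1) t ≤ s ∧
    -- `s + 1 = r` is `s = r - 1` without truncation
    (t = r ∨ t = s ∨ (t = r ∧ r = s) ∨ s + 1 = r) := by
  have h₁ : min r s ≤ t := by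
    refine ENat.forall_natCast_le_iff_le.mp fun n hn => ?_
    obtain ⟨hnr, hns⟩ := le_min_iff.mp hn
    rw [hr, natCast_le_pairDepth_iff] at hnr
    rw [hs, natCast_le_pairDepth_iff] at hns
    rw [ht, natCast_le_pairDepth_iff]
    exact fun 𝔞 h𝔞 => (hnr 𝔞 h𝔞).middle_of_exact hf hfg hg (hns 𝔞 h𝔞)
  have h₂ : min t (s + 1) ≤ r := by
    refine ENat.forall_natCast_le_iff_le.mp fun n hn => ?_
    obtain _ | n := n
    · simp
    obtain ⟨hnt, hns⟩ := le_min_iff.mp hn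
    rw [Nat.cast_succ, ENat.add_le_add_iff_right ENat.one_ne_top, hs, natCast_le_pairDepth_iff] at hns
    rw [ht, natCast_le_pairDepth_iff] at hnt
    rw [hr, natCast_le_pairDepth_iff]
    exact fun 𝔞 h𝔞 => (hnt 𝔞 h𝔞).left_of_exact hf hfg hg (hns 𝔞 h𝔞)
  have h₃ : min (r - 1) t ≤ s := by
    refine ENat.forall_natCast_le_iff_le.mp fun n hn => ?_
    obtain ⟨hnr, hnt⟩ := le_min_iff.mp hn
    obtain rfl | hn0 := Nat.eq_zero_or_pos n
    · simp
    -- Needs `n > 0`: with truncated subtraction, `0 ≤ r - 1` says nothing about `r`.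
    have hnr : ((n + 1 : ℕ) : ℕ∞) ≤ r := by
      induction r using ENat.recTopCoe with
      | top => exact le_top
      | coe r =>
        norm_cast at hnr ⊢
        omega
    rw [hr, natCast_le_pairDepth_iff] at hnr
    rw [ht, natCast_le_pairDepth_iff] at hnt
    rw [hs, natCast_le_pairDepth_iff]
    exact fun 𝔞 h𝔞 => (hnr 𝔞 h𝔞).right_of_exact hf hfg hg (hnt 𝔞 h𝔞)
  refine ⟨h₁, h₂, h₃, ?_⟩
  rcases ENat.eq_or_eq_or_add_one_eq_of_min_le h₁ h₂ h₃ with h | h | h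
  exacts [.inl h, .inr (.inl h), .inr (.inr (.inr h))]
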